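/- Let $\alpha>0$ be real and $m\ge 0$ an integer. Let $L_n^{(\alpha)}(z)=\sum_{k=0}^n(-1)^k\binom{n+\alpha}{n-k}\frac{z^k}{k!}$ be the classical Laguerre polynomials, put $\xi_{\alpha,m}(z)=L_m^{(\alpha)}(-z)$, and for $j\ge 0$ let $$L^{\mathrm I}_{\alpha,m,m+j}(z)=\xi_{\alpha,m}(z)\,L_j^{(\alpha-1)}(z)-\xi_{\alpha-1,m}(z)\,\bigl(L_j^{(\alpha-1)}\bigr)'(z)$$ be the type I exceptional $X_m$-Laguerre polynomial of degree $m+j$. For every $j$ this polynomial has exactly $j$ distinct zeros in $[0,\infty)$ (its regular zeros); denote them by $x_{j,1}<x_{j,2}<\dots<x_{j,j}$. The Bessel function of the first kind $J_\alpha$ has infinitely many positive zeros, and they can be listed as an increasing sequence $\tilde z^{(\alpha)}_1<\tilde z^{(\alpha)}_2<\cdots$. Moreover, for every fixed $i\ge 1$, $$\lim_{j\to\infty} j\,x_{j,i}=\frac{\bigl(\tilde z^{(\alpha)}_i\bigr)^2}{4}.$$ -/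

import Mathlib

open Polynomial

noncomputable section

/-- The Laguerre polynomial `L_n^{(α)}` with real parameter `α`,
`∑_{k=0}^n (-1)^k binom(n+α, n-k) x^k / k!`, where
`binom(n+α, n-k) = (α+k+1)(α+k+2)⋯(α+n) / (n-k)!`. -/
def laguerreL (α : ℝ) (n : ℕ) : ℝ[X] :=
  ∑ k ∈ Finset.range (n + 1),
    C ((-1) ^ k * ((ascPochhammer ℝ (n - k)).eval (α + k + 1) / (n - k).factorial)
      / k.factorial) * X ^ k

/-- `ξ_{α,m}(z) = L_m^{(α)}(-z)`. -/
def xiPoly (α : ℝ) (m : ℕ) : ℝ[X] := (laguerreL α m).comp (-X)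

/-- The first order operator `A^I_{α,m}[y] = ξ_{α,m} y' - ξ_{α+1,m} y` on polynomials. -/
def opAI (α : ℝ) (m : ℕ) (y : ℝ[X]) : ℝ[X] :=
  xiPoly α m * derivative y - xiPoly (α + 1) m * y

/-- The type I exceptional `X_m`-Laguerre polynomial `L^I_{α,m,m+j}` of degree `m + j`,
namely `-A^I_{α-1,m}[L_j^{(α-1)}]`. -/
def xLaguerreI (α : ℝ) (m j : ℕ) : ℝ[X] := -opAI (α - 1) m (laguerreL (α - 1) j)

/-- The regular zeros of `L^I_{α,m,m+j}`: its zeros in `[0, ∞)`. -/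
def regularZeros (α : ℝ) (m j : ℕ) : Set ℝ :=
  {x | 0 ≤ x ∧ (xLaguerreI α m j).eval x = 0}

/-- The Bessel function of the first kind of real order `α`, for positive real argument:
`J_α(t) = (t/2)^α ∑_k (-1)^k / (k! Γ(α+k+1)) (t/2)^{2k}`. -/
def besselJ (α t : ℝ) : ℝ :=
  (t / 2) ^ α *
    ∑' k : ℕ, (-1) ^ k / (k.factorial * Real.Gamma (α + k + 1)) * (t / 2) ^ (2 * k)

/-- The positive zeros of the Bessel function `J_α`. -/
def besselZeros (α : ℝ) : Set ℝ := {t | 0 < t ∧ besselJ α t = 0}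

/-- `u`, restricted to the index set `I`, lists the elements of `S` in increasing order, each of
them exactly once. -/
def ListsIncreasing (u : ℕ → ℝ) (I : Set ℕ) (S : Set ℝ) : Prop :=
  StrictMonoOn u I ∧ u '' I = S

end

/-!
The proof is by real analysis only. Write `ξ = ξ_{α-1,m}` and `y = L_j^{(α-1)}`; since
`ξ_{α,m} = ξ + ξ'`, the exceptional polynomial is `P = (ξ + ξ') y - ξ y'`.

*Number of regular zeros.* On `[0, ∞)`, where `ξ > 0`, the zeros of `P` are the critical points of
`exp (-x) y / ξ`. This function vanishes at infinity and at the `j` positive zeros of `y`, so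
Rolle's theorem (`exists_finset_deriv_eq_zero`) gives `j` positive zeros of `P`. The substitution
`x ↦ -x` exchanges `ξ` and `y` (`xLaguerreI_comp_neg`), so `P` also has `m` negative zeros. As the
degree is at most `m + j`, there are no others (`exists_finset_eq_regularZeros`). The zeros of
Laguerre polynomials themselves come from the same Rolle argument applied to the Rodrigues formula.

*Bessel zeros.* Up to a positive factor, `J_α(t)` is `f(t² / 4)` with `f(x) = ₀F₁(; α + 1; -x)`. The
positive zeros of `f` are simple by a contiguous relation (`zeroFOne_add_one_ne_zero`), hence
locally finite, and unbounded because the differential equation of `f` is oscillatory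
(`not_eventually_pos_of_system`).

*Limit.* Divided by `L_{j-1}^{(α)}(0)`, the function `x ↦ P(x / j)` and its derivative converge
locally uniformly to `ξ(0) f` and its derivative, by dominated convergence of the hypergeometric
series (`tendsto_laguerreL_scaled`). Because the zeros of the limit are simple and `P` is known
to have its zeros listed in order, the `i`-th zeros converge (`tendsto_listed_zeros`).
-/

open Filter Topology

/-! ### Coefficient identities for Laguerre polynomials -/

lemma ascPochhammer_eval_succ_left (c : ℝ) (n : ℕ) :
    (ascPochhammer ℝ (n + 1)).eval c = c * (ascPochhammer ℝ n).eval (c + 1) := by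
  simp [ascPochhammer_succ_left, eval_comp]

lemma laguerreL_coeff_add (α : ℝ) (k d : ℕ) :
    (laguerreL α (k + d)).coeff k =
      (-1) ^ k * ((ascPochhammer ℝ d).eval (α + k + 1) / d.factorial) / k.factorial := by
  simp only [laguerreL, finsetSum_coeff, coeff_C_mul, coeff_X_pow]
  rw [Finset.sum_eq_single k]
  · simp
  · intro b _ hb
    simp [hb.symm]
  · intro h
    simp at h

lemma laguerreL_coeff_of_lt (α : ℝ) {n k : ℕ} (h : n < k) : (laguerreL α n).coeff k = 0 := by
  simp only [laguerreL, finsetSum_coeff, coeff_C_mul, coeff_X_pow]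
  refine Finset.sum_eq_zero fun b hb => ?_
  have : k ≠ b := by
    have := Finset.mem_range.1 hb
    omega
  simp [this]

lemma natDegree_laguerreL_le (α : ℝ) (n : ℕ) : (laguerreL α n).natDegree ≤ n :=
  natDegree_le_iff_coeff_eq_zero.2 fun _ h => laguerreL_coeff_of_lt α h

lemma laguerreL_zero (α : ℝ) : laguerreL α 0 = 1 := by
  simp [laguerreL]

lemma derivative_laguerreL_succ (α : ℝ) (n : ℕ) :
    derivative (laguerreL α (n + 1)) = -laguerreL (α + 1) n := by
  ext k
  rw [coeff_derivative, coeff_neg]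
  rcases lt_or_ge n k with h | h
  · rw [laguerreL_coeff_of_lt _ h, laguerreL_coeff_of_lt _ (by omega)]
    simp
  · obtain ⟨d, rfl⟩ := Nat.exists_eq_add_of_le h
    rw [show k + d + 1 = (k + 1) + d by ring, laguerreL_coeff_add, laguerreL_coeff_add,
      Nat.factorial_succ]
    push_cast
    rw [show α + ((k : ℝ) + 1) + 1 = α + 1 + k + 1 by ring]
    field_simp
    ring

/-- The Rodrigues formula in differential form: multiplied by `x ^ α * exp (-x)`, the right-hand
side is the derivative of `x ^ (α + 1) * exp (-x) * L_n^{(α+1)}`. -/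
lemma succ_mul_laguerreL_succ (α : ℝ) (n : ℕ) :
    C ((n : ℝ) + 1) * laguerreL α (n + 1) =
      (C (α + 1) - X) * laguerreL (α + 1) n + X * derivative (laguerreL (α + 1) n) := by
  ext k
  rw [coeff_C_mul, coeff_add, sub_mul, coeff_sub, coeff_C_mul]
  rcases k with _ | k
  · have h1 := laguerreL_coeff_add α 0 (n + 1)
    have h2 := laguerreL_coeff_add (α + 1) 0 n
    rw [zero_add] at h1 h2
    rw [h1, h2, ascPochhammer_eval_succ_left, Nat.factorial_succ]
    simp only [mul_coeff_zero, coeff_X_zero]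
    push_cast
    rw [show α + 0 + 1 + 1 = α + 1 + 0 + 1 by ring]
    field_simp
    ring
  · rw [coeff_X_mul, coeff_X_mul, coeff_derivative]
    rcases lt_trichotomy n k with h | h | h
    · rw [laguerreL_coeff_of_lt _ h, laguerreL_coeff_of_lt _ (by omega : n + 1 < k + 1),
        laguerreL_coeff_of_lt _ (by omega : n < k + 1)]
      simp
    · subst h
      have h1 := laguerreL_coeff_add α (n + 1) 0
      have h2 := laguerreL_coeff_add (α + 1) n 0
      rw [add_zero] at h1 h2
      rw [laguerreL_coeff_of_lt _ (Nat.lt_succ_self n), h1, h2, Nat.factorial_succ]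
      simp only [ascPochhammer_zero, eval_one, Nat.factorial_zero, Nat.cast_one]
      push_cast
      field_simp
      ring
    · obtain ⟨d, rfl⟩ := Nat.exists_eq_add_of_lt h
      have h1 := laguerreL_coeff_add α (k + 1) (d + 1)
      have h2 := laguerreL_coeff_add (α + 1) (k + 1) d
      have h3 := laguerreL_coeff_add (α + 1) k (d + 1)
      rw [show k + 1 + (d + 1) = k + d + 1 + 1 by ring] at h1
      rw [show k + 1 + d = k + d + 1 by ring] at h2
      rw [show k + (d + 1) = k + d + 1 by ring] at h3
      rw [h1, h2, h3, ascPochhammer_eval_succ_left, ascPochhammer_eval_succ_left,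
        Nat.factorial_succ k, Nat.factorial_succ d]
      push_cast
      rw [show α + 1 + ((k : ℝ) + 1) + 1 = α + k + 3 by ring,
        show α + 1 + (k : ℝ) + 1 + 1 = α + k + 3 by ring,
        show α + ((k : ℝ) + 1) + 1 + 1 = α + k + 3 by ring]
      field_simp
      ring

lemma laguerreL_add_one (α : ℝ) (n : ℕ) :
    laguerreL (α + 1) n = laguerreL α n - derivative (laguerreL α n) := by
  ext k
  rw [coeff_sub, coeff_derivative]
  rcases lt_trichotomy n k with h | h | h
  · rw [laguerreL_coeff_of_lt _ h, laguerreL_coeff_of_lt _ h,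
      laguerreL_coeff_of_lt _ (by omega : n < k + 1)]
    simp
  · subst h
    have h1 := laguerreL_coeff_add α n 0
    have h2 := laguerreL_coeff_add (α + 1) n 0
    rw [add_zero] at h1 h2
    rw [laguerreL_coeff_of_lt _ (Nat.lt_succ_self n), h1, h2]
    simp
  · obtain ⟨d, rfl⟩ := Nat.exists_eq_add_of_lt h
    have h1 := laguerreL_coeff_add (α + 1) k (d + 1)
    have h2 := laguerreL_coeff_add α k (d + 1)
    have h3 := laguerreL_coeff_add α (k + 1) d
    rw [show k + (d + 1) = k + d + 1 by ring] at h1 h2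
    rw [show k + 1 + d = k + d + 1 by ring] at h3
    rw [h1, h2, h3, ascPochhammer_eval_succ_left (α + k + 1), ascPochhammer_succ_eval,
      Nat.factorial_succ k, Nat.factorial_succ d]
    push_cast
    rw [show α + 1 + (k : ℝ) + 1 = α + k + 2 by ring,
      show α + (k : ℝ) + 1 + 1 = α + k + 2 by ring,
      show α + ((k : ℝ) + 1) + 1 = α + k + 2 by ring]
    field_simp
    ring

lemma laguerreL_eval_zero (α : ℝ) (n : ℕ) :
    (laguerreL α n).eval 0 = (ascPochhammer ℝ n).eval (α + 1) / n.factorial := by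
  have := laguerreL_coeff_add α 0 n
  rw [zero_add] at this
  rw [← coeff_zero_eq_eval_zero, this]
  simp

lemma laguerreL_eval_zero_pos {α : ℝ} (hα : -1 < α) (n : ℕ) : 0 < (laguerreL α n).eval 0 := by
  rw [laguerreL_eval_zero]
  have := ascPochhammer_pos n (α + 1) (by linarith)
  positivity

lemma xiPoly_eval (α : ℝ) (m : ℕ) (x : ℝ) :
    (xiPoly α m).eval x = (laguerreL α m).eval (-x) := by
  simp [xiPoly, eval_comp]

lemma xiPoly_comp_neg (α : ℝ) (m : ℕ) : (xiPoly α m).comp (-X) = laguerreL α m := by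
  simp [xiPoly, comp_assoc]

lemma xiPoly_add_one (α : ℝ) (m : ℕ) :
    xiPoly (α + 1) m = xiPoly α m + derivative (xiPoly α m) := by
  simp [xiPoly, laguerreL_add_one, derivative_comp, sub_eq_add_neg]

/-- Every coefficient of `L_m^{(α)}(-x)` is nonnegative for `α > -1`, so on `[0, ∞)` it is bounded
below by its value at `0`. -/
lemma xiPoly_eval_zero_le {α : ℝ} (hα : -1 < α) (m : ℕ) {x : ℝ} (hx : 0 ≤ x) :
    (laguerreL α m).eval 0 ≤ (xiPoly α m).eval x := by
  rw [xiPoly_eval, laguerreL, eval_finsetSum, eval_finsetSum]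
  refine Finset.sum_le_sum fun k _ => ?_
  have hp := ascPochhammer_pos (m - k) (α + k + 1) (by have : (0 : ℝ) ≤ k := k.cast_nonneg; linarith)
  rcases k with _ | k
  · simp
  · have h : ((-1 : ℝ) ^ (k + 1)) * (-x) ^ (k + 1) = x ^ (k + 1) := by
      rw [← mul_pow]
      simp
    have e : eval (-x) (C ((-1) ^ (k + 1) * ((ascPochhammer ℝ (m - (k + 1))).eval
        (α + (k + 1 : ℕ) + 1) / (m - (k + 1)).factorial) / (k + 1).factorial) * X ^ (k + 1)) =
        (ascPochhammer ℝ (m - (k + 1))).eval (α + (k + 1 : ℕ) + 1) / (m - (k + 1)).factorial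
          / (k + 1).factorial * x ^ (k + 1) := by
      simp only [eval_mul, eval_C, eval_pow, eval_X]
      rw [← h]
      ring
    rw [e]
    simp only [eval_mul, eval_C, eval_pow, eval_X]
    rw [zero_pow (Nat.succ_ne_zero k), mul_zero]
    positivity

/-! ### Rolle's theorem on a half-line -/

/-- Rolle's theorem on `[a, ∞)`, the second zero being at infinity. -/
lemma exists_deriv_eq_zero_of_tendsto_zero {f f' : ℝ → ℝ} {a : ℝ}
    (hc : ContinuousOn f (Set.Ici a)) (hd : ∀ x, a < x → HasDerivAt f (f' x) x)
    (h0 : f a = 0) (hlim : Tendsto f atTop (𝓝 0)) : ∃ c, a < c ∧ f' c = 0 := by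
  by_cases hz : ∀ x, a < x → f x = 0
  · obtain ⟨c, hc1, hc2⟩ := exists_hasDerivAt_eq_zero (f := f) (f' := f') (lt_add_one a)
      (hc.mono Set.Icc_subset_Ici_self) (by rw [h0, hz _ (lt_add_one a)])
      (fun x hx => hd x hx.1)
    exact ⟨c, hc1.1, hc2⟩
  · push Not at hz
    obtain ⟨b, hab, hb⟩ := hz
    -- Both `[a, b]` and some `[b, d]` contain a point where `f` takes the value `f b / 2`.
    have hb2 : |f b| / 2 > 0 := by positivity
    obtain ⟨d, hbd, hd'⟩ : ∃ d, b < d ∧ |f d| < |f b| / 2 := by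
      have h1 : ∀ᶠ x in atTop, |f x| < |f b| / 2 := by
        have := hlim.abs
        rw [abs_zero] at this
        exact this.eventually_lt_const hb2
      obtain ⟨d, h2, h3⟩ := ((eventually_gt_atTop b).and h1).exists
      exact ⟨d, h2, h3⟩
    have key : ∃ p q, a ≤ p ∧ p < b ∧ b < q ∧ f p = f q := by
      have c1 : ContinuousOn f (Set.Icc a b) := hc.mono Set.Icc_subset_Ici_self
      have c2 : ContinuousOn f (Set.Icc b d) :=
        hc.mono fun x hx => le_trans hab.le hx.1
      rcases lt_or_gt_of_ne hb with h | h
      · rw [abs_of_neg h] at hd' hb2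
        have := abs_lt.1 hd'
        obtain ⟨p, hp, hp'⟩ := intermediate_value_Icc' hab.le c1
          (show f b / 2 ∈ Set.Icc (f b) (f a) from ⟨by linarith, by linarith⟩)
        obtain ⟨q, hq, hq'⟩ := intermediate_value_Icc hbd.le c2
          (show f b / 2 ∈ Set.Icc (f b) (f d) from ⟨by linarith, by linarith⟩)
        refine ⟨p, q, hp.1, lt_of_le_of_ne hp.2 ?_, lt_of_le_of_ne hq.1 ?_, by rw [hp', hq']⟩
        · rintro rfl; linarith
        · rintro rfl; linarith
      · rw [abs_of_pos h] at hd' hb2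
        have := abs_lt.1 hd'
        obtain ⟨p, hp, hp'⟩ := intermediate_value_Icc hab.le c1
          (show f b / 2 ∈ Set.Icc (f a) (f b) from ⟨by linarith, by linarith⟩)
        obtain ⟨q, hq, hq'⟩ := intermediate_value_Icc' hbd.le c2
          (show f b / 2 ∈ Set.Icc (f d) (f b) from ⟨by linarith, by linarith⟩)
        refine ⟨p, q, hp.1, lt_of_le_of_ne hp.2 ?_, lt_of_le_of_ne hq.1 ?_, by rw [hp', hq']⟩
        · rintro rfl; linarith
        · rintro rfl; linarith
    obtain ⟨p, q, hap, hpb, hbq, hpq⟩ := key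
    obtain ⟨c, hc1, hc2⟩ := exists_hasDerivAt_eq_zero (f := f) (f' := f') (hpb.trans hbq)
      (hc.mono fun x hx => le_trans hap hx.1) hpq (fun x hx => hd x (lt_of_le_of_lt hap hx.1))
    exact ⟨c, lt_of_le_of_lt hap hc1.1, hc2⟩

/-- A function on `[a, ∞)` that tends to `0` at infinity has at least as many critical points as
zeros, because infinity counts as one more zero. -/
lemma exists_finset_deriv_eq_zero {f f' : ℝ → ℝ} {a : ℝ}
    (hc : ContinuousOn f (Set.Ici a)) (hd : ∀ x, a < x → HasDerivAt f (f' x) x)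
    (hlim : Tendsto f atTop (𝓝 0)) (s : Finset ℝ) (hs : ∀ x ∈ s, a ≤ x ∧ f x = 0) :
    ∃ t : Finset ℝ, t.card = s.card ∧ (∀ x ∈ t, f' x = 0) ∧ ∀ x ∈ t, ∃ y ∈ s, y < x := by
  induction s using Finset.induction_on_min with
  | empty => exact ⟨∅, by simp⟩
  | insert b s hb ih =>
    obtain ⟨t, ht1, ht2, ht3⟩ := ih fun x hx => hs x (Finset.mem_insert_of_mem hx)
    obtain ⟨hab, hfb⟩ := hs b (Finset.mem_insert_self b s)
    have hbs : b ∉ s := fun h => lt_irrefl _ (hb b h)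
    have hcb : ContinuousOn f (Set.Ici b) := hc.mono (Set.Ici_subset_Ici.2 hab)
    obtain ⟨c, hbc, hc0, hcs⟩ : ∃ c, b < c ∧ f' c = 0 ∧ ∀ y ∈ s, c < y := by
      rcases s.eq_empty_or_nonempty with rfl | hne
      · obtain ⟨c, h1, h2⟩ := exists_deriv_eq_zero_of_tendsto_zero hcb
          (fun x hx => hd x (lt_of_le_of_lt hab hx)) hfb hlim
        exact ⟨c, h1, h2, by simp⟩
      · obtain ⟨c, h1, h2⟩ := exists_hasDerivAt_eq_zero (f := f) (f' := f')
          (hb _ (s.min'_mem hne)) (hcb.mono Set.Icc_subset_Ici_self)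
          (by rw [hfb, (hs _ (Finset.mem_insert_of_mem (s.min'_mem hne))).2])
          (fun x hx => hd x (lt_of_le_of_lt hab hx.1))
        exact ⟨c, h1.1, h2, fun y hy => lt_of_lt_of_le h1.2 (s.min'_le y hy)⟩
    have hct : c ∉ t := fun h => by
      obtain ⟨y, hy, hyc⟩ := ht3 c h
      exact lt_asymm hyc (hcs y hy)
    refine ⟨insert c t, ?_, ?_, ?_⟩
    · rw [Finset.card_insert_of_notMem hct, Finset.card_insert_of_notMem hbs, ht1]
    · intro x hx
      rcases Finset.mem_insert.1 hx with rfl | hx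
      · exact hc0
      · exact ht2 x hx
    · intro x hx
      rcases Finset.mem_insert.1 hx with rfl | hx
      · exact ⟨b, Finset.mem_insert_self b s, hbc⟩
      · obtain ⟨y, hy, hyx⟩ := ht3 x hx
        exact ⟨y, Finset.mem_insert_of_mem hy, hyx⟩

/-! ### Zeros of Laguerre and exceptional Laguerre polynomials -/

lemma exists_finset_laguerreL_zeros (n : ℕ) : ∀ {α : ℝ}, -1 < α →
    ∃ s : Finset ℝ, s.card = n ∧ ∀ x ∈ s, 0 < x ∧ (laguerreL α n).eval x = 0 := by
  induction n with
  | zero => exact fun _ => ⟨∅, by simp⟩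
  | succ n ih =>
    intro α hα
    obtain ⟨s, hs1, hs2⟩ := ih (α := α + 1) (by linarith)
    set q := laguerreL (α + 1) n
    let f : ℝ → ℝ := fun x => x ^ (α + 1) * (q.eval x / Real.exp x)
    let f' : ℝ → ℝ := fun x =>
      x ^ α * Real.exp (-x) * (((n : ℝ) + 1) * (laguerreL α (n + 1)).eval x)
    have h0s : (0 : ℝ) ∉ s := fun h => lt_irrefl _ (hs2 0 h).1
    have hc : ContinuousOn f (Set.Ici 0) := by
      refine ContinuousOn.mul ?_ ?_
      · exact (Real.continuous_rpow_const (by linarith)).continuousOn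
      · exact (q.continuous.div Real.continuous_exp fun x => (Real.exp_pos x).ne').continuousOn
    have hd : ∀ x, 0 < x → HasDerivAt f (f' x) x := by
      intro x hx
      have h1 := Real.hasDerivAt_rpow_const (x := x) (p := α + 1) (Or.inl hx.ne')
      have h2 := (q.hasDerivAt x).div (Real.hasDerivAt_exp x) (Real.exp_pos x).ne'
      have h3 : HasDerivAt f _ x := h1.mul h2
      refine h3.congr_deriv ?_
      have e := congrArg (eval x) (succ_mul_laguerreL_succ α n)
      simp only [eval_mul, eval_add, eval_sub, eval_C, eval_X] at e
      simp only [f']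
      rw [e, add_sub_cancel_right, Real.exp_neg, Real.rpow_add_one hx.ne']
      have := (Real.exp_pos x).ne'
      field_simp
      ring
    have hlim : Tendsto f atTop (𝓝 0) := by
      obtain ⟨k, hk⟩ := exists_nat_ge (α + 1)
      -- The power `x ^ (α + 1)` is dominated by `x ^ k`, which turns `f` into a polynomial over
      -- the exponential.
      have h1 := Polynomial.tendsto_div_exp_atTop (X ^ k * q)
      refine squeeze_zero_norm' ?_ (tendsto_norm_zero.comp h1)
      filter_upwards [eventually_ge_atTop 1] with x hx
      simp only [Function.comp_apply, f, eval_mul, eval_pow, eval_X, mul_div_assoc, norm_mul]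
      gcongr
      rw [Real.norm_of_nonneg (by positivity), Real.norm_of_nonneg (by positivity),
        ← Real.rpow_natCast]
      exact Real.rpow_le_rpow_of_exponent_le hx hk
    obtain ⟨t, ht1, ht2, ht3⟩ := exists_finset_deriv_eq_zero hc hd hlim (insert 0 s) (by
      intro x hx
      rcases Finset.mem_insert.1 hx with rfl | hx
      · exact ⟨le_rfl, by simp [f, Real.zero_rpow (by linarith : α + 1 ≠ 0)]⟩
      · exact ⟨(hs2 x hx).1.le, by simp [f, (hs2 x hx).2]⟩)
    refine ⟨t, by rw [ht1, Finset.card_insert_of_notMem h0s, hs1], fun x hx => ?_⟩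
    have hx0 : 0 < x := by
      obtain ⟨y, hy, hyx⟩ := ht3 x hx
      rcases Finset.mem_insert.1 hy with rfl | hy
      · exact hyx
      · exact (hs2 y hy).1.trans hyx
    refine ⟨hx0, ?_⟩
    have h := ht2 x hx
    have h1 := (Real.rpow_pos_of_pos hx0 α).ne'
    have h2 := (Real.exp_pos (-x)).ne'
    have h3 : (n : ℝ) + 1 ≠ 0 := by positivity
    simpa [f', h1, h2, h3] using h

/-- If `A` has `n` positive zeros and `B` is bounded below by a positive constant on `[0, ∞)`, then
`(B + B') A - B A'` has `n` positive zeros: up to a factor without zeros it is the derivative of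
`exp (-x) A / B`. -/
lemma exists_finset_zeros_add_derivative_mul_sub {A B : ℝ[X]} {c : ℝ} (hc : 0 < c)
    (hB : ∀ x, 0 ≤ x → c ≤ B.eval x) (s : Finset ℝ)
    (hs : ∀ x ∈ s, 0 < x ∧ A.eval x = 0) :
    ∃ t : Finset ℝ, t.card = s.card ∧
      ∀ x ∈ t, 0 < x ∧ ((B + derivative B) * A - B * derivative A).eval x = 0 := by
  let f : ℝ → ℝ := fun x => A.eval x / Real.exp x / B.eval x
  let f' : ℝ → ℝ := fun x => -((B + derivative B) * A - B * derivative A).eval x /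
    (Real.exp x * B.eval x ^ 2)
  have hB0 : ∀ x, 0 ≤ x → 0 < B.eval x := fun x hx => hc.trans_le (hB x hx)
  have hd : ∀ x, 0 ≤ x → HasDerivAt f (f' x) x := by
    intro x hx
    have h : HasDerivAt f _ x := ((A.hasDerivAt x).div (Real.hasDerivAt_exp x) (Real.exp_pos x).ne').div
      (B.hasDerivAt x) (hB0 x hx).ne'
    refine h.congr_deriv ?_
    have h1 := (Real.exp_pos x).ne'
    have h2 := (hB0 x hx).ne'
    simp only [f', Pi.div_apply, eval_mul, eval_add, eval_sub]
    field_simp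
    ring
  have hlim : Tendsto f atTop (𝓝 0) := by
    have h1 := (Polynomial.tendsto_div_exp_atTop A).norm.div_const c
    rw [norm_zero, zero_div] at h1
    refine squeeze_zero_norm' ?_ h1
    filter_upwards [eventually_ge_atTop 0] with x hx
    simp only [f]
    rw [norm_div (_ / _)]
    have h2 : c ≤ ‖B.eval x‖ := (hB x hx).trans (le_abs_self _)
    gcongr
  obtain ⟨t, ht1, ht2, ht3⟩ := exists_finset_deriv_eq_zero (f := f) (f' := f') (a := 0)
    (fun x hx => (hd x hx).continuousAt.continuousWithinAt) (fun x hx => hd x hx.le) hlim s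
    (fun x hx => ⟨(hs x hx).1.le, by simp [f, (hs x hx).2]⟩)
  refine ⟨t, ht1, fun x hx => ?_⟩
  obtain ⟨y, hy, hyx⟩ := ht3 x hx
  have hx0 : 0 < x := (hs y hy).1.trans hyx
  refine ⟨hx0, ?_⟩
  have h := ht2 x hx
  have h1 := (Real.exp_pos x).ne'
  have h2 := (hB0 x hx0.le).ne'
  simp only [f', div_eq_zero_iff, neg_eq_zero, mul_eq_zero, h1, pow_eq_zero_iff two_ne_zero, h2,
    or_self, or_false] at h
  exact h

/-- The exceptional polynomial in terms of `ξ = ξ_{α-1,m}` and `y = L_j^{(α-1)}` alone. -/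
lemma xLaguerreI_eq (α : ℝ) (m j : ℕ) : xLaguerreI α m j =
    (xiPoly (α - 1) m + derivative (xiPoly (α - 1) m)) * laguerreL (α - 1) j -
      xiPoly (α - 1) m * derivative (laguerreL (α - 1) j) := by
  rw [xLaguerreI, opAI, xiPoly_add_one]
  ring

/-- Reflection `x ↦ -x` exchanges the roles of the two Laguerre polynomials from which the
exceptional polynomial is built. -/
lemma xLaguerreI_comp_neg (α : ℝ) (m j : ℕ) :
    (xLaguerreI α m j).comp (-X) = xLaguerreI α j m := by
  simp only [xLaguerreI_eq, sub_comp, add_comp, mul_comp, xiPoly_comp_neg]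
  have h1 : (derivative (xiPoly (α - 1) m)).comp (-X) = -derivative (laguerreL (α - 1) m) := by
    simp [xiPoly, derivative_comp, comp_assoc]
  have h2 : (derivative (laguerreL (α - 1) j)).comp (-X) = -derivative (xiPoly (α - 1) j) := by
    simp [xiPoly, derivative_comp]
  rw [h1, h2, show (laguerreL (α - 1) j).comp (-X) = xiPoly (α - 1) j from rfl]
  ring

lemma xLaguerreI_eval_zero_pos {α : ℝ} (hα : 0 < α) (m j : ℕ) :
    0 < (xLaguerreI α m j).eval 0 := by
  have h1 : 0 < (xiPoly α m).eval 0 :=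
    (laguerreL_eval_zero_pos (by linarith) m).trans_le (xiPoly_eval_zero_le (by linarith) m le_rfl)
  have h2 : 0 < (xiPoly (α - 1) m).eval 0 :=
    (laguerreL_eval_zero_pos (by linarith) m).trans_le (xiPoly_eval_zero_le (by linarith) m le_rfl)
  have h3 : 0 < (laguerreL (α - 1) j).eval 0 := laguerreL_eval_zero_pos (by linarith) j
  have h4 : (derivative (laguerreL (α - 1) j)).eval 0 ≤ 0 := by
    rcases j with _ | j
    · simp [laguerreL_zero]
    · rw [derivative_laguerreL_succ, eval_neg, sub_add_cancel]
      linarith [laguerreL_eval_zero_pos (by linarith : -1 < α) j]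
  simp only [xLaguerreI, opAI, sub_add_cancel, eval_neg, eval_sub, eval_mul]
  nlinarith [mul_pos h1 h3, mul_nonneg h2.le (neg_nonneg.2 h4)]

lemma natDegree_xLaguerreI_le (α : ℝ) (m j : ℕ) : (xLaguerreI α m j).natDegree ≤ m + j := by
  have hxi : ∀ β : ℝ, (xiPoly β m).natDegree ≤ m := fun β => by
    rw [xiPoly, natDegree_comp]
    simpa using natDegree_laguerreL_le β m
  have hy := natDegree_laguerreL_le (α - 1) j
  rw [xLaguerreI, opAI, natDegree_neg]
  refine (natDegree_sub_le _ _).trans (max_le ?_ ?_)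
  · exact natDegree_mul_le.trans (add_le_add (hxi _)
      ((natDegree_derivative_le _).trans ((Nat.sub_le _ _).trans hy)))
  · exact natDegree_mul_le.trans (add_le_add (hxi _) hy)

lemma exists_finset_xLaguerreI_zeros {α : ℝ} (hα : 0 < α) (m j : ℕ) :
    ∃ s : Finset ℝ, s.card = j ∧ ∀ x ∈ s, 0 < x ∧ (xLaguerreI α m j).eval x = 0 := by
  obtain ⟨s, hs1, hs2⟩ := exists_finset_laguerreL_zeros j (by linarith : -1 < α - 1)
  obtain ⟨t, ht1, ht2⟩ := exists_finset_zeros_add_derivative_mul_sub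
    (laguerreL_eval_zero_pos (by linarith : -1 < α - 1) m)
    (fun x hx => xiPoly_eval_zero_le (by linarith) m hx) s hs2
  exact ⟨t, ht1.trans hs1, fun x hx => by rw [xLaguerreI_eq]; exact ht2 x hx⟩

/-- The lower bound `j` on the number of positive zeros is attained, as the reflected polynomial
accounts for `m` negative zeros and the degree is `m + j`. -/
lemma exists_finset_eq_regularZeros {α : ℝ} (hα : 0 < α) (m j : ℕ) :
    ∃ s : Finset ℝ, s.card = j ∧ (s : Set ℝ) = regularZeros α m j := by
  have hne : xLaguerreI α m j ≠ 0 := fun h => by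
    have := xLaguerreI_eval_zero_pos hα m j
    simp [h] at this
  obtain ⟨s, hs1, hs2⟩ := exists_finset_xLaguerreI_zeros hα m j
  obtain ⟨t, ht1, ht2⟩ := exists_finset_xLaguerreI_zeros hα j m
  let r := (xLaguerreI α m j).roots.toFinset
  have hr : ∀ x, x ∈ r ↔ (xLaguerreI α m j).eval x = 0 := fun x => by
    simp [r, hne]
  let a := r.filter (0 ≤ ·)
  let b := r.filter (¬ 0 ≤ ·)
  have hab : a.card + b.card ≤ m + j := by
    rw [Finset.card_filter_add_card_filter_not]
    exact (Multiset.toFinset_card_le _).trans ((card_roots' _).trans (natDegree_xLaguerreI_le α m j))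
  have hsa : s ⊆ a := fun x hx => Finset.mem_filter.2 ⟨(hr x).2 (hs2 x hx).2, (hs2 x hx).1.le⟩
  have htb : t.image (-·) ⊆ b := by
    intro x hx
    obtain ⟨y, hy, rfl⟩ := Finset.mem_image.1 hx
    refine Finset.mem_filter.2 ⟨(hr _).2 ?_, by linarith [(ht2 y hy).1]⟩
    have h := (ht2 y hy).2
    rw [← xLaguerreI_comp_neg, eval_comp] at h
    simpa using h
  have h1 := Finset.card_le_card htb
  rw [Finset.card_image_of_injective _ neg_injective] at h1
  have h2 := Finset.eq_of_subset_of_card_le hsa (by omega)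
  refine ⟨s, hs1, ?_⟩
  ext x
  rw [h2]
  simp [a, hr, regularZeros, and_comm]

lemma exists_listsIncreasing_of_finset (s : Finset ℝ) :
    ∃ u : ℕ → ℝ, ListsIncreasing u (Set.Icc 1 s.card) s := by
  let e := s.orderEmbOfFin rfl
  refine ⟨fun i => if h : i - 1 < s.card then e ⟨i - 1, h⟩ else 0, ?_, ?_⟩
  · intro a ha b hb hab
    simp only [Set.mem_Icc] at ha hb
    simp only [dif_pos (by omega : a - 1 < s.card), dif_pos (by omega : b - 1 < s.card)]
    refine e.strictMono ?_
    rw [Fin.mk_lt_mk]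
    omega
  · rw [← Finset.range_orderEmbOfFin s rfl]
    ext x
    constructor
    · rintro ⟨i, hi, rfl⟩
      simp only [Set.mem_Icc] at hi
      simp only [dif_pos (by omega : i - 1 < s.card)]
      exact ⟨_, rfl⟩
    · rintro ⟨i, rfl⟩
      refine ⟨i + 1, ⟨by omega, by omega⟩, ?_⟩
      simp [e]

/-! ### The entire function behind the Bessel function -/

/-- The `k`-th term `(-x)^k / ((c)_k k!)` of the confluent hypergeometric series
`₀F₁(; c; -x)`. -/
noncomputable def zeroFOneTerm (c : ℝ) (k : ℕ) (x : ℝ) : ℝ :=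
  (-x) ^ k / ((ascPochhammer ℝ k).eval c * k.factorial)

/-- The confluent hypergeometric limit function `₀F₁(; c; -x)`. -/
noncomputable def zeroFOne (c x : ℝ) : ℝ := ∑' k, zeroFOneTerm c k x

lemma one_le_ascPochhammer_eval {c : ℝ} (hc : 1 ≤ c) (k : ℕ) :
    1 ≤ (ascPochhammer ℝ k).eval c := by
  induction k with
  | zero => simp
  | succ k ih =>
    rw [ascPochhammer_succ_eval]
    have : (0 : ℝ) ≤ k := k.cast_nonneg
    nlinarith

lemma min_one_le_ascPochhammer_eval {c : ℝ} (hc : 0 < c) (k : ℕ) :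
    min 1 c ≤ (ascPochhammer ℝ k).eval c := by
  rcases k with _ | k
  · simp
  · rw [ascPochhammer_eval_succ_left]
    have := one_le_ascPochhammer_eval (by linarith : 1 ≤ c + 1) k
    exact (min_le_right _ _).trans (by nlinarith)

/-- A summable majorant, uniform in `x` on bounded sets and in `c` away from `0`. -/
lemma abs_zeroFOneTerm_le {c R x : ℝ} (hc : 0 < c) (hx : |x| ≤ R) (k : ℕ) :
    |zeroFOneTerm c k x| ≤ R ^ k / k.factorial * (min 1 c)⁻¹ := by
  have h1 := min_one_le_ascPochhammer_eval hc k
  have h2 : 0 < min 1 c := lt_min one_pos hc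
  have h3 : (0 : ℝ) < k.factorial := by positivity
  rw [zeroFOneTerm, abs_div, abs_pow, abs_neg, abs_mul, abs_of_pos (h2.trans_le h1),
    abs_of_pos h3, ← div_eq_mul_inv, div_div, mul_comm (k.factorial : ℝ)]
  have : 0 ≤ R := (abs_nonneg x).trans hx
  gcongr

lemma summable_zeroFOneTerm_bound (c R : ℝ) :
    Summable fun k : ℕ => R ^ k / k.factorial * (min 1 c)⁻¹ :=
  (Real.summable_pow_div_factorial R).mul_right _

lemma summable_zeroFOneTerm {c : ℝ} (hc : 0 < c) (x : ℝ) :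
    Summable fun k => zeroFOneTerm c k x :=
  (summable_zeroFOneTerm_bound c |x|).of_norm_bounded fun k => abs_zeroFOneTerm_le hc le_rfl k

lemma zeroFOneTerm_zero (c x : ℝ) : zeroFOneTerm c 0 x = 1 := by simp [zeroFOneTerm]

lemma zeroFOne_zero (c : ℝ) : zeroFOne c 0 = 1 := by
  rw [zeroFOne, tsum_eq_single 0 fun k hk => by simp [zeroFOneTerm, hk], zeroFOneTerm_zero]

lemma hasDerivAt_zeroFOneTerm_succ {c : ℝ} (hc : 0 < c) (k : ℕ) (x : ℝ) :
    HasDerivAt (zeroFOneTerm c (k + 1)) (-(zeroFOneTerm (c + 1) k x) / c) x := by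
  have h : HasDerivAt (zeroFOneTerm c (k + 1)) _ x :=
    ((hasDerivAt_neg x).pow (k + 1)).div_const _
  refine h.congr_deriv ?_
  have h1 := (ascPochhammer_pos k (c + 1) (by linarith)).ne'
  rw [zeroFOneTerm, ascPochhammer_eval_succ_left, Nat.factorial_succ]
  simp only [Nat.add_sub_cancel]
  push_cast
  field_simp

lemma hasDerivAt_zeroFOne {c : ℝ} (hc : 0 < c) (x : ℝ) :
    HasDerivAt (zeroFOne c) (-(zeroFOne (c + 1) x) / c) x := by
  have hball : ∀ y ∈ Metric.ball (0 : ℝ) (|x| + 1), |y| ≤ |x| + 1 := fun y hy => by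
    rw [mem_ball_zero_iff] at hy
    exact hy.le
  have h := hasDerivAt_tsum_of_isPreconnected (g := fun k y => zeroFOneTerm c (k + 1) y)
    (g' := fun k y => -(zeroFOneTerm (c + 1) k y) / c) (t := Metric.ball 0 (|x| + 1)) (y₀ := x)
    ((summable_zeroFOneTerm_bound (c + 1) (|x| + 1)).div_const c) Metric.isOpen_ball
    (convex_ball _ _).isPreconnected (fun k y _ => hasDerivAt_zeroFOneTerm_succ hc k y)
    (fun k y hy => by
      rw [norm_div, norm_neg, Real.norm_of_nonneg hc.le]
      gcongr
      exact abs_zeroFOneTerm_le (by linarith) (hball y hy) k)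
    (by simp) ((summable_nat_add_iff 1).2 (summable_zeroFOneTerm hc x))
    (by simp : x ∈ Metric.ball (0 : ℝ) (|x| + 1))
  have h2 := (h.const_add 1).congr_deriv
    (show _ = -(zeroFOne (c + 1) x) / c by rw [tsum_div_const, tsum_neg]; rfl)
  refine h2.congr_of_eventuallyEq (Eventually.of_forall fun y => ?_)
  change zeroFOne c y = 1 + _
  rw [zeroFOne, (summable_zeroFOneTerm hc y).tsum_eq_zero_add, zeroFOneTerm_zero]

lemma continuous_zeroFOne {c : ℝ} (hc : 0 < c) : Continuous (zeroFOne c) :=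
  continuous_iff_continuousAt.2 fun x => (hasDerivAt_zeroFOne hc x).continuousAt

lemma zeroFOne_eq_sub {c : ℝ} (hc : 0 < c) (x : ℝ) :
    zeroFOne c x = zeroFOne (c + 1) x - x / (c * (c + 1)) * zeroFOne (c + 2) x := by
  have hs := summable_zeroFOneTerm (by linarith : 0 < c + 2) x
  have h0 := summable_zeroFOneTerm hc x
  have h1 := summable_zeroFOneTerm (by linarith : 0 < c + 1) x
  simp only [zeroFOne]
  rw [h0.tsum_eq_zero_add, h1.tsum_eq_zero_add, zeroFOneTerm_zero, zeroFOneTerm_zero,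
    add_sub_assoc, ← tsum_mul_left, ← ((summable_nat_add_iff 1).2 h1).tsum_sub (hs.mul_left _)]
  congr 2
  ext k
  have e1 := (ascPochhammer_pos k (c + 1) (by linarith)).ne'
  have e2 := (ascPochhammer_pos k (c + 2) (by linarith)).ne'
  have e3 : (ascPochhammer ℝ k).eval (c + 1) * (c + 1 + k) =
      (c + 1) * (ascPochhammer ℝ k).eval (c + 2) := by
    rw [← ascPochhammer_succ_eval, ascPochhammer_eval_succ_left]
    ring_nf
  have e4 : c + 1 + k ≠ 0 := by positivity
  have e5 : (ascPochhammer ℝ k).eval (c + 2) =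
      (ascPochhammer ℝ k).eval (c + 1) * (c + 1 + k) / (c + 1) := by
    rw [e3]
    field_simp
  rw [zeroFOneTerm, zeroFOneTerm, zeroFOneTerm, ascPochhammer_eval_succ_left c,
    ascPochhammer_succ_eval _ (c + 1), e5, Nat.factorial_succ]
  push_cast
  field_simp
  ring

lemma tendsto_zeroFOne_add_nat {c : ℝ} (hc : 0 < c) (x : ℝ) :
    Tendsto (fun n : ℕ => zeroFOne (c + n) x) atTop (𝓝 1) := by
  have hg : ∑' k : ℕ, (if k = 0 then (1 : ℝ) else 0) = 1 := by simp
  rw [← hg]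
  refine tendsto_tsum_of_dominated_convergence (summable_zeroFOneTerm_bound 1 |x|) ?_ ?_
  · intro k
    rcases k with _ | k
    · simp [zeroFOneTerm_zero]
    · simp only [Nat.succ_ne_zero, if_false]
      have ht : Tendsto (fun n : ℕ => |x| ^ (k + 1) / (c + n)) atTop (𝓝 0) :=
        (tendsto_const_nhds.div_atTop
          (tendsto_atTop_add_const_left _ _ tendsto_natCast_atTop_atTop))
      refine squeeze_zero_norm (fun n => ?_) ht
      have h0 : 0 < c + n := by positivity
      have h1 := one_le_ascPochhammer_eval (by linarith : 1 ≤ c + n + 1 ) k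
      have h2 : (1 : ℝ) ≤ (k + 1).factorial := by 
        exact_mod_cast (k + 1).factorial_pos
      rw [zeroFOneTerm, norm_div, norm_pow, norm_neg, Real.norm_eq_abs x,
        ascPochhammer_eval_succ_left, Real.norm_of_nonneg (by positivity)]
      gcongr
      nlinarith [mul_le_mul h1 h2 zero_le_one (by linarith)]
  · filter_upwards [eventually_ge_atTop 1] with n hn k
    have h1 : (1 : ℝ) ≤ c + n := by
      have : (1 : ℝ) ≤ n := by exact_mod_cast hn
      linarith
    have h := abs_zeroFOneTerm_le (by linarith : 0 < c + n) (le_refl |x|) k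
    rwa [min_eq_left h1, ← min_self (1 : ℝ)] at h

/-- Positive zeros are simple: by the contiguous relation, a common zero of `₀F₁(; c; -x)` and its
derivative would be a zero of every `₀F₁(; c + n; -x)`, and these tend to `1`. -/
lemma zeroFOne_add_one_ne_zero {c w : ℝ} (hc : 0 < c) (hw : 0 < w) (h0 : zeroFOne c w = 0) :
    zeroFOne (c + 1) w ≠ 0 := by
  intro h1
  have key : ∀ n : ℕ, zeroFOne (c + n) w = 0 ∧ zeroFOne (c + n + 1) w = 0 := by
    intro n
    induction n with
    | zero => simpa using ⟨h0, h1⟩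
    | succ n ih =>
      have hp : 0 < c + n := by positivity
      have h := zeroFOne_eq_sub hp w
      rw [ih.1, ih.2] at h
      have h2 : w / ((c + n) * (c + n + 1)) ≠ 0 := by positivity
      have h3 : zeroFOne (c + n + 2) w = 0 := by
        have : w / ((c + n) * (c + n + 1)) * zeroFOne (c + n + 2) w = 0 := by linarith
        exact (mul_eq_zero.1 this).resolve_left h2
      push_cast
      rw [show c + ((n : ℝ) + 1) = c + n + 1 by ring, show c + (n : ℝ) + 1 + 1 = c + n + 2 by ring]
      exact ⟨ih.2, h3⟩
  have ht := tendsto_zeroFOne_add_nat hc w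
  simp only [fun n => (key n).1] at ht
  exact zero_ne_one (tendsto_nhds_unique tendsto_const_nhds ht)

/-! ### Oscillation and the list of Bessel zeros -/

lemma monotoneOn_Ici_of_hasDerivAt_nonneg {f f' : ℝ → ℝ} {a : ℝ}
    (hd : ∀ x, a ≤ x → HasDerivAt f (f' x) x) (h : ∀ x, a ≤ x → 0 ≤ f' x) :
    MonotoneOn f (Set.Ici a) := by
  refine monotoneOn_of_hasDerivWithinAt_nonneg (f' := f') (convex_Ici a)
    (fun x hx => (hd x hx).continuousAt.continuousWithinAt) ?_ ?_
  · intro x hx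
    rw [interior_Ici] at hx
    exact (hd x hx.le).hasDerivWithinAt
  · intro x hx
    rw [interior_Ici] at hx
    exact h x hx.le

/-- A solution of `(x^{a+1} f')' = -x^a f` with `a > 0`, written as a first-order system with
`G = -x^{a+1} f'`, is not eventually positive: otherwise `G` would be eventually positive and at
most `a x^a f`, so `G' ≥ G / a` would force exponential growth of `G`, whereas `f` is
decreasing. -/
lemma not_eventually_pos_of_system {a T : ℝ} (ha : 0 < a) (hT : 0 < T) {f G : ℝ → ℝ}
    (hf : ∀ x, T ≤ x → HasDerivAt f (-(x ^ (-a - 1) * G x)) x)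
    (hG : ∀ x, T ≤ x → HasDerivAt G (x ^ a * f x) x) (hpos : ∀ x, T ≤ x → 0 < f x) : False := by
  have hGmono : MonotoneOn G (Set.Ici T) := monotoneOn_Ici_of_hasDerivAt_nonneg hG fun x hx =>
    (mul_pos (Real.rpow_pos_of_pos (hT.trans_le hx) a) (hpos x hx)).le
  obtain ⟨S, hTS, hGS⟩ : ∃ S, T ≤ S ∧ 0 < G S := by
    by_contra! hcon
    have hfm : MonotoneOn f (Set.Ici T) := monotoneOn_Ici_of_hasDerivAt_nonneg hf fun x hx => by
      have := Real.rpow_pos_of_pos (hT.trans_le hx) (-a - 1)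
      nlinarith [hcon x hx]
    have hδ : 0 < T ^ a * f T := mul_pos (Real.rpow_pos_of_pos hT a) (hpos T le_rfl)
    have hlin : MonotoneOn (fun x => G x - T ^ a * f T * x) (Set.Ici T) := by
      refine monotoneOn_Ici_of_hasDerivAt_nonneg
        (fun x hx => (hG x hx).sub ((hasDerivAt_id x).const_mul (T ^ a * f T))) fun x hx => ?_
      have h1 : T ^ a ≤ x ^ a := Real.rpow_le_rpow hT.le hx ha.le
      have h2 : f T ≤ f x := hfm Set.self_mem_Ici hx hx
      have := mul_le_mul h1 h2 (hpos T le_rfl).le (Real.rpow_nonneg (hT.le.trans hx) a)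
      linarith
    have hx : T ≤ T + (1 - G T) / (T ^ a * f T) :=
      le_add_of_nonneg_right (div_nonneg (by linarith [hcon T le_rfl]) hδ.le)
    have h3 := hlin Set.self_mem_Ici hx hx
    simp only [mul_add] at h3
    rw [mul_div_cancel₀ _ hδ.ne'] at h3
    linarith [hcon _ hx]
  have hGpos : ∀ x, S ≤ x → 0 < G x := fun x hx =>
    hGS.trans_le (hGmono hTS (hTS.trans hx) hx)
  have hfanti : ∀ x, S ≤ x → f x ≤ f S := by
    have : MonotoneOn (fun x => -f x) (Set.Ici S) := monotoneOn_Ici_of_hasDerivAt_nonneg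
      (fun x hx => (hf x (hTS.trans hx)).neg) fun x hx => by
        have := mul_pos (Real.rpow_pos_of_pos (hT.trans_le (hTS.trans hx)) (-a - 1)) (hGpos x hx)
        linarith
    intro x hx
    have := this Set.self_mem_Ici hx hx
    simp only at this
    linarith
  -- Integrating `-f' = y^{-a-1} G y ≥ y^{-a-1} G x` over `[x, ∞)` and using `f > 0` bounds `G x`.
  have hGle : ∀ x, S ≤ x → G x ≤ a * (x ^ a * f x) := by
    intro x hx
    have hx0 : 0 < x := hT.trans_le (hTS.trans hx)
    have hm : MonotoneOn (fun y => G x / a * y ^ (-a) - f y) (Set.Ici x) := by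
      refine monotoneOn_Ici_of_hasDerivAt_nonneg
        (fun y hy => ((Real.hasDerivAt_rpow_const (p := -a)
          (Or.inl (hx0.trans_le hy).ne')).const_mul (G x / a)).sub
          (hf y (hTS.trans (hx.trans hy)))) fun y hy => ?_
      have h1 : G x ≤ G y := hGmono (hTS.trans hx) (hTS.trans (hx.trans hy)) hy
      have h2 := Real.rpow_pos_of_pos (hx0.trans_le hy) (-a - 1)
      have h3 : G x / a * (-a * y ^ (-a - 1)) = -(G x * y ^ (-a - 1)) := by field_simp
      rw [h3]
      nlinarith
    have hlim : Tendsto (fun y : ℝ => G x / a * y ^ (-a)) atTop (𝓝 0) := by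
      simpa using (tendsto_rpow_neg_atTop ha).const_mul (G x / a)
    have hle : G x / a * x ^ (-a) - f x ≤ 0 := by
      refine ge_of_tendsto hlim ?_
      filter_upwards [eventually_ge_atTop x] with y hy
      have := hm Set.self_mem_Ici hy hy
      simp only at this
      linarith [hpos y (hTS.trans (hx.trans hy))]
    have h4 := Real.rpow_pos_of_pos hx0 a
    rw [Real.rpow_neg hx0.le] at hle
    have h5 : G x = (G x / a * (x ^ a)⁻¹) * (a * x ^ a) := by field_simp
    rw [h5]
    nlinarith [mul_pos ha h4]
  have hexp : MonotoneOn (fun x => G x * Real.exp (-a⁻¹ * x)) (Set.Ici S) := by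
    refine monotoneOn_Ici_of_hasDerivAt_nonneg
      (fun x hx => (hG x (hTS.trans hx)).mul
        ((hasDerivAt_id x).const_mul (-a⁻¹)).exp) fun x hx => ?_
    have h1 := hGle x hx
    have h2 := Real.exp_pos (-a⁻¹ * x)
    have h3 : a⁻¹ * G x ≤ x ^ a * f x := by
      rw [inv_mul_le_iff₀ ha]
      exact h1
    simp only [id]
    nlinarith
  have hlim : Tendsto (fun x : ℝ => a * f S * (x ^ a * Real.exp (-a⁻¹ * x))) atTop (𝓝 0) := by
    simpa using (tendsto_rpow_mul_exp_neg_mul_atTop_nhds_zero a a⁻¹ (inv_pos.2 ha)).const_mul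
      (a * f S)
  have hle : G S * Real.exp (-a⁻¹ * S) ≤ 0 := by
    refine ge_of_tendsto hlim ?_
    filter_upwards [eventually_ge_atTop S] with x hx
    have h1 := hexp Set.self_mem_Ici hx hx
    simp only at h1
    refine h1.trans ?_
    have h2 : G x ≤ a * f S * x ^ a := by
      have h3 := hGle x hx
      have h4 := Real.rpow_nonneg (hT.le.trans (hTS.trans hx)) a
      nlinarith [mul_le_mul_of_nonneg_left (hfanti x hx) (mul_nonneg ha.le h4)]
    have h5 := (Real.exp_pos (-a⁻¹ * x)).le
    nlinarith [mul_le_mul_of_nonneg_right h2 h5]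
  exact absurd hle (not_le.2 (mul_pos hGS (Real.exp_pos _)))

lemma exists_gt_zeroFOne_eq_zero {a : ℝ} (ha : 0 < a) (T : ℝ) :
    ∃ x, T < x ∧ zeroFOne (a + 1) x = 0 := by
  by_contra! hcon
  have hc : 0 < a + 1 := by linarith
  set S := max T 0 + 1 with hS
  have hTS : T < S := by linarith [le_max_left T 0]
  have hS0 : 0 < S := by linarith [le_max_right T 0]
  -- Both signs of the function satisfy the same linear system.
  have hsys : ∀ σ : ℝ, ¬ ∀ x, S ≤ x → 0 < σ * zeroFOne (a + 1) x := by
    intro σ hσ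
    refine not_eventually_pos_of_system ha hS0
      (f := fun x => σ * zeroFOne (a + 1) x)
      (G := fun x => σ * (x ^ (a + 1) * (zeroFOne (a + 1 + 1) x / (a + 1)))) ?_ ?_ hσ
    · intro x hx
      have hx0 : 0 < x := hS0.trans_le hx
      refine ((hasDerivAt_zeroFOne hc x).const_mul σ).congr_deriv ?_
      have h1 : x ^ (-a - 1) * x ^ (a + 1) = 1 := by
        rw [← Real.rpow_add hx0]
        simp
      linear_combination (σ * (zeroFOne (a + 1 + 1) x / (a + 1))) * h1
    · intro x hx
      have hx0 : 0 < x := hS0.trans_le hx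
      refine (((Real.hasDerivAt_rpow_const (p := a + 1) (Or.inl hx0.ne')).mul
        ((hasDerivAt_zeroFOne (by linarith : 0 < a + 1 + 1) x).div_const (a + 1))).const_mul
        σ).congr_deriv ?_
      rw [zeroFOne_eq_sub hc x, add_sub_cancel_right, Real.rpow_add_one hx0.ne',
        show a + 1 + 1 + 1 = a + 1 + 2 by ring]
      field_simp
      ring
  have hconst : (∀ x, S ≤ x → 0 < zeroFOne (a + 1) x) ∨ ∀ x, S ≤ x → zeroFOne (a + 1) x < 0 := by
    have hcont := (continuous_zeroFOne hc).continuousOn (s := Set.Ici S)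
    by_contra! h
    obtain ⟨⟨x, hx, hx'⟩, y, hy, hy'⟩ := h
    obtain ⟨z, hz, hz'⟩ := (isPreconnected_Ici (a := S)).intermediate_value hx hy hcont ⟨hx', hy'⟩
    exact hcon z (hTS.trans_le hz) hz'
  rcases hconst with h | h
  · exact hsys 1 fun x hx => by simpa using h x hx
  · exact hsys (-1) fun x hx => by simpa using h x hx

/-- Simple zeros of a differentiable function do not accumulate. -/
lemma finite_zeros_Icc_of_deriv_ne_zero {f f' : ℝ → ℝ} {a b : ℝ}
    (hd : ∀ x, HasDerivAt f (f' x) x) (hs : ∀ x ∈ Set.Icc a b, f x = 0 → f' x ≠ 0) :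
    {x ∈ Set.Icc a b | f x = 0}.Finite := by
  by_contra hinf
  obtain ⟨w, hw, hacc⟩ := Set.Infinite.exists_accPt_of_subset_isCompact hinf isCompact_Icc
    (fun x hx => hx.1)
  have hfreq := accPt_iff_frequently_nhdsNE.1 hacc
  have hcont : ContinuousAt f w := (hd w).continuousAt
  have hw0 : f w = 0 := by
    by_contra hne
    have h1 : ∀ᶠ x in 𝓝[≠] w, f x ≠ 0 :=
      (hcont.eventually_ne hne).filter_mono nhdsWithin_le_nhds
    obtain ⟨x, hx1, hx2⟩ := (hfreq.and_eventually h1).exists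
    exact hx2 hx1.2
  obtain ⟨x, hx1, hx2⟩ := (hfreq.and_eventually
    ((hd w).eventually_ne (c := 0) (hs w hw hw0))).exists
  exact hx2 hx1.2

lemma exists_listsIncreasing_of_finite_inter_Iic {S : Set ℝ} (hfin : ∀ b, (S ∩ Set.Iic b).Finite)
    (hunb : ∀ b, ∃ x ∈ S, b < x) : ∃ z : ℕ → ℝ, ListsIncreasing z (Set.Ici 1) S := by
  classical
  have hIcc : ∀ a b : S, (Set.Icc a b).Finite := fun a b => by
    refine Set.Finite.of_finite_image ((hfin b).subset ?_) Subtype.val_injective.injOn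
    rintro _ ⟨x, hx, rfl⟩
    exact ⟨x.2, hx.2⟩
  let _ : LocallyFiniteOrder S := LocallyFiniteOrder.ofFiniteIcc hIcc
  obtain ⟨x₀, hx₀, -⟩ := hunb 0
  have hx₀' : x₀ ∈ S ∩ Set.Iic x₀ := ⟨hx₀, Set.self_mem_Iic⟩
  obtain ⟨b, hb, hbmin⟩ := Set.exists_min_image (S ∩ Set.Iic x₀) id (hfin x₀)
    ⟨x₀, hx₀'⟩
  let _ : OrderBot S :=
    { bot := ⟨b, hb.1⟩
      bot_le := fun x => by
        rcases le_total (x : ℝ) x₀ with h | h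
        · exact hbmin x ⟨x.2, h⟩
        · exact (show b ≤ x from hb.2.trans h) }
  have : NoMaxOrder S := ⟨fun x => by
    obtain ⟨y, hy, hxy⟩ := hunb x
    exact ⟨⟨y, hy⟩, hxy⟩⟩
  let _ : SuccOrder S := LinearLocallyFiniteOrder.succOrder S
  let _ : PredOrder S := LinearLocallyFiniteOrder.predOrder S
  let e : S ≃o ℕ := orderIsoNatOfLinearSuccPredArch
  refine ⟨fun i => e.symm (i - 1), ?_, ?_⟩
  · intro i hi j hj hij
    simp only [Set.mem_Ici] at hi hj
    exact e.symm.strictMono (by omega)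
  · ext x
    constructor
    · rintro ⟨i, -, rfl⟩
      exact (e.symm (i - 1)).2
    · intro hx
      refine ⟨e ⟨x, hx⟩ + 1, by simp, by simp⟩

lemma Gamma_add_nat_eq_ascPochhammer_mul {c : ℝ} (hc : 0 < c) (k : ℕ) :
    Real.Gamma (c + k) = (ascPochhammer ℝ k).eval c * Real.Gamma c := by
  induction k with
  | zero => simp
  | succ k ih =>
    have : c + k ≠ 0 := by positivity
    rw [Nat.cast_succ, ← add_assoc, Real.Gamma_add_one this, ih, ascPochhammer_succ_eval]
    ring

lemma besselJ_eq_zeroFOne {α : ℝ} (hα : -1 < α) (t : ℝ) :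
    besselJ α t = (t / 2) ^ α * ((Real.Gamma (α + 1))⁻¹ * zeroFOne (α + 1) (t ^ 2 / 4)) := by
  rw [besselJ]
  congr 1
  rw [zeroFOne, ← tsum_mul_left]
  refine tsum_congr fun k => ?_
  rw [show α + k + 1 = α + 1 + k by ring, Gamma_add_nat_eq_ascPochhammer_mul (by linarith),
    zeroFOneTerm, neg_pow (t ^ 2 / 4), pow_mul, show (t / 2) ^ 2 = t ^ 2 / 4 by ring]
  have h1 := (ascPochhammer_pos k (α + 1) (by linarith)).ne'
  have h2 := (Real.Gamma_pos_of_pos (by linarith : 0 < α + 1)).ne'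
  field_simp

lemma mem_besselZeros_iff {α : ℝ} (hα : -1 < α) {t : ℝ} :
    t ∈ besselZeros α ↔ 0 < t ∧ zeroFOne (α + 1) (t ^ 2 / 4) = 0 := by
  refine and_congr_right fun ht => ?_
  have h1 := (Real.rpow_pos_of_pos (by linarith : 0 < t / 2) α).ne'
  have h2 := (Real.Gamma_pos_of_pos (by linarith : 0 < α + 1)).ne'
  rw [besselJ_eq_zeroFOne hα]
  simp [h1, h2]

lemma exists_listsIncreasing_besselZeros {α : ℝ} (hα : 0 < α) :
    ∃ z : ℕ → ℝ, ListsIncreasing z (Set.Ici 1) (besselZeros α) := by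
  have hα1 : -1 < α := by linarith
  refine exists_listsIncreasing_of_finite_inter_Iic (fun b => ?_) fun b => ?_
  · have hfin := finite_zeros_Icc_of_deriv_ne_zero (a := 0) (b := b ^ 2 / 4)
      (hasDerivAt_zeroFOne (by linarith : 0 < α + 1)) (fun x hx h0 => by
        have hx0 : 0 < x := lt_of_le_of_ne hx.1 fun h => by
          rw [← h, zeroFOne_zero] at h0
          exact one_ne_zero h0
        have h1 := zeroFOne_add_one_ne_zero (by linarith) hx0 h0
        exact div_ne_zero (neg_ne_zero.2 h1) (by linarith))
    refine Set.Finite.of_finite_image (f := fun t => t ^ 2 / 4) (hfin.subset ?_) ?_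
    · rintro _ ⟨t, ⟨ht, htb⟩, rfl⟩
      obtain ⟨ht0, ht1⟩ := (mem_besselZeros_iff hα1).1 ht
      have htb' : t ≤ b := htb
      exact ⟨⟨by positivity, by nlinarith⟩, ht1⟩
    · rintro s ⟨hs, -⟩ t ⟨ht, -⟩ hst
      have hst' : s ^ 2 = t ^ 2 := by simp only at hst; linarith
      exact (pow_left_inj₀ hs.1.le ht.1.le two_ne_zero).1 hst'
  · obtain ⟨x, hx, hx0⟩ := exists_gt_zeroFOne_eq_zero hα (b ^ 2 / 4)
    have hx1 : 0 ≤ x := le_trans (by positivity) hx.le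
    have hxp : 0 < x := lt_of_le_of_lt (by positivity) hx
    have hsq : (2 * √x) ^ 2 / 4 = x := by
      rw [mul_pow, Real.sq_sqrt hx1]
      ring
    refine ⟨2 * √x, (mem_besselZeros_iff hα1).2 ⟨by positivity, by rw [hsq]; exact hx0⟩, ?_⟩
    refine lt_of_pow_lt_pow_left₀ 2 (by positivity) ?_
    linarith

/-! ### Convergence of zeros -/

/-- For functions `p N` converging to a continuous limit jointly in `N` and the point, a limit
without zeros on a compact interval forces `p N` to have none there for large `N`. -/
lemma eventually_forall_Icc_ne_zero {p : ℕ → ℝ → ℝ} {f : ℝ → ℝ} {a b : ℝ}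
    (hp : ∀ x ∈ Set.Icc a b, Tendsto (fun q : ℕ × ℝ => p q.1 q.2) (atTop ×ˢ 𝓝 x) (𝓝 (f x)))
    (hf : ∀ x ∈ Set.Icc a b, f x ≠ 0) : ∀ᶠ N in atTop, ∀ x ∈ Set.Icc a b, p N x ≠ 0 := by
  have h : ∀ᶠ q : ℕ × ℝ in atTop ×ˢ 𝓝ˢ (Set.Icc a b), p q.1 q.2 ≠ 0 :=
    isCompact_Icc.mem_prod_nhdsSet_of_forall fun x hx => (hp x hx).eventually_ne (hf x hx)
  exact h.curry.mono fun N hN x hx => hN.self_of_nhdsSet x hx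

lemma tendsto_of_tendsto_prod {p : ℕ → ℝ → ℝ} {x l : ℝ}
    (hp : Tendsto (fun q : ℕ × ℝ => p q.1 q.2) (atTop ×ˢ 𝓝 x) (𝓝 l)) :
    Tendsto (fun N => p N x) atTop (𝓝 l) :=
  hp.comp (tendsto_id.prodMk tendsto_const_nhds)

lemma exists_zero_of_mul_neg {f : ℝ → ℝ} {a b : ℝ} (hab : a ≤ b) (hf : ContinuousOn f (Set.Icc a b))
    (h : f a * f b < 0) : ∃ x ∈ Set.Icc a b, f x = 0 := by
  rcases mul_neg_iff.1 h with ⟨h1, h2⟩ | ⟨h1, h2⟩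
  · exact intermediate_value_Icc' hab hf ⟨h2.le, h1.le⟩
  · exact intermediate_value_Icc hab hf ⟨h1.le, h2.le⟩

lemma injOn_Icc_of_deriv_ne_zero {f f' : ℝ → ℝ} {a b : ℝ} (hd : ∀ x, HasDerivAt f (f' x) x)
    (h : ∀ x ∈ Set.Icc a b, f' x ≠ 0) : Set.InjOn f (Set.Icc a b) := by
  have hlt : ∀ x ∈ Set.Icc a b, ∀ y ∈ Set.Icc a b, x < y → f x ≠ f y := by
    intro x hx y hy hxy hfe
    obtain ⟨c, hc1, hc2⟩ := exists_hasDerivAt_eq_zero hxy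
      (fun z _ => (hd z).continuousAt.continuousWithinAt) hfe fun z _ => hd z
    exact h c ⟨hx.1.trans hc1.1.le, hc1.2.le.trans hy.2⟩ hc2
  intro x hx y hy hfe
  rcases lt_trichotomy x y with h1 | h1 | h1
  · exact absurd hfe (hlt x hx y hy h1)
  · exact h1
  · exact absurd hfe.symm (hlt y hy x hx h1)

/-- If `w` is the first zero in `[c, ∞)` of the limit and is simple, then the first zeros `v N` in
`[c, ∞)` of the functions `p N` tend to `w`. Moreover a fixed interval to the right of `w` is free
of further zeros of `p N` for large `N`. -/
lemma tendsto_of_isLeast_zero {p p' : ℕ → ℝ → ℝ} {f f' : ℝ → ℝ} {v : ℕ → ℝ} {c w : ℝ}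
    (hp : ∀ N x, HasDerivAt (p N) (p' N x) x) (hf : ∀ x, HasDerivAt f (f' x) x)
    (hf' : Continuous f') (hc : 0 ≤ c) (hcw : c < w)
    (hpf : ∀ x, 0 ≤ x → Tendsto (fun q : ℕ × ℝ => p q.1 q.2) (atTop ×ˢ 𝓝 x) (𝓝 (f x)))
    (hpf' : ∀ x, 0 ≤ x → Tendsto (fun q : ℕ × ℝ => p' q.1 q.2) (atTop ×ˢ 𝓝 x) (𝓝 (f' x)))
    (hne : ∀ x ∈ Set.Ico c w, f x ≠ 0) (hw : f w = 0) (hw' : f' w ≠ 0)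
    (hv : ∀ᶠ N in atTop, IsLeast {x | c ≤ x ∧ p N x = 0} (v N)) :
    Tendsto v atTop (𝓝 w) ∧
      ∃ r, w < r ∧ ∀ d, w < d → d < r →
        ∀ᶠ N in atTop, v N < d ∧ ∀ x, v N < x → p N x = 0 → d ≤ x := by
  obtain ⟨ε, hε, hεne⟩ : ∃ ε > 0, ∀ x, |x - w| < ε → f' x ≠ 0 := by
    obtain ⟨ε, h1, h2⟩ := Metric.eventually_nhds_iff.1 (hf'.continuousAt.eventually_ne hw')
    exact ⟨ε, h1, fun x hx => h2 hx⟩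
  obtain ⟨δ₀, hδ₀, hδε, hδc⟩ : ∃ δ₀ > 0, δ₀ < ε ∧ δ₀ < w - c := by
    obtain ⟨δ, h1, h2⟩ := exists_between (lt_min hε (sub_pos.2 hcw))
    exact ⟨δ, h1, h2.trans_le (min_le_left _ _), h2.trans_le (min_le_right _ _)⟩
  have hfne : ∀ x ∈ Set.Icc (w - δ₀) (w + δ₀), f' x ≠ 0 := fun x hx =>
    hεne x (abs_lt.2 ⟨by linarith [hx.1], by linarith [hx.2]⟩)
  have hinj := injOn_Icc_of_deriv_ne_zero hf hfne
  have hnear : ∀ δ, 0 < δ → δ ≤ δ₀ → ∀ᶠ N in atTop, v N ∈ Set.Icc (w - δ) (w + δ) := by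
    intro δ hδ hδδ
    have hm1 : w - δ ∈ Set.Icc (w - δ₀) (w + δ₀) := ⟨by linarith, by linarith⟩
    have hm2 : w + δ ∈ Set.Icc (w - δ₀) (w + δ₀) := ⟨by linarith, by linarith⟩
    have hm : w ∈ Set.Icc (w - δ₀) (w + δ₀) := ⟨by linarith, by linarith⟩
    have hsign : f (w - δ) * f (w + δ) < 0 := by
      rcases ContinuousOn.strictMonoOn_of_injOn_Icc' (by linarith : w - δ₀ ≤ w + δ₀)
        (fun z _ => (hf z).continuousAt.continuousWithinAt) hinj with h | h
      · have h1 := h hm1 hm (by linarith)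
        have h2 := h hm hm2 (by linarith)
        rw [hw] at h1 h2
        exact mul_neg_of_neg_of_pos h1 h2
      · have h1 := h hm1 hm (by linarith)
        have h2 := h hm hm2 (by linarith)
        rw [hw] at h1 h2
        exact mul_neg_of_pos_of_neg h1 h2
    have hsignN := ((tendsto_of_tendsto_prod (hpf (w - δ) (by linarith))).mul
      (tendsto_of_tendsto_prod (hpf (w + δ) (by linarith)))).eventually_lt_const hsign
    have hleft := eventually_forall_Icc_ne_zero (a := c) (b := w - δ)
      (fun x hx => hpf x (hc.trans hx.1))
      (fun x hx => hne x ⟨hx.1, lt_of_le_of_lt hx.2 (by linarith)⟩)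
    filter_upwards [hsignN, hleft, hv] with N h1 h2 h3
    constructor
    · by_contra! hlt
      exact h2 (v N) ⟨h3.1.1, hlt.le⟩ h3.1.2
    · obtain ⟨x, hx, hx0⟩ := exists_zero_of_mul_neg (by linarith)
        (fun z _ => (hp N z).continuousAt.continuousWithinAt) h1
      exact (h3.2 ⟨by linarith [hx.1], hx0⟩).trans hx.2
  have htend : Tendsto v atTop (𝓝 w) := by
    refine Metric.tendsto_nhds.2 fun η hη => ?_
    filter_upwards [hnear (min (η / 2) δ₀) (lt_min (by linarith) hδ₀) (min_le_right _ _)]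
      with N hN
    have := min_le_left (η / 2) δ₀
    rw [Real.dist_eq, abs_lt]
    exact ⟨by linarith [hN.1], by linarith [hN.2]⟩
  refine ⟨htend, w + δ₀, by linarith, fun d hd hdr => ?_⟩
  have hp'ne := eventually_forall_Icc_ne_zero (a := w - δ₀) (b := w + δ₀)
    (fun x hx => hpf' x (by linarith [hx.1])) hfne
  filter_upwards [htend.eventually_lt_const hd, hp'ne, hnear δ₀ hδ₀ le_rfl, hv] with N h1 h2 h3 h4
  refine ⟨h1, fun x hx hx0 => ?_⟩
  by_contra! hlt
  exact hx.ne (injOn_Icc_of_deriv_ne_zero (hp N) h2 h3 ⟨by linarith [h3.1], by linarith⟩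
    (h4.1.2.trans hx0.symm))

/-- Convergence of the `i`-th zero in `[0, ∞)`, under joint convergence of the functions and of
their derivatives to a limit with simple zeros. -/
lemma tendsto_listed_zeros {p p' : ℕ → ℝ → ℝ} {f f' : ℝ → ℝ} {u : ℕ → ℕ → ℝ} {w : ℕ → ℝ}
    (hp : ∀ N x, HasDerivAt (p N) (p' N x) x) (hf : ∀ x, HasDerivAt f (f' x) x)
    (hf' : Continuous f')
    (hpf : ∀ x, 0 ≤ x → Tendsto (fun q : ℕ × ℝ => p q.1 q.2) (atTop ×ˢ 𝓝 x) (𝓝 (f x)))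
    (hpf' : ∀ x, 0 ≤ x → Tendsto (fun q : ℕ × ℝ => p' q.1 q.2) (atTop ×ˢ 𝓝 x) (𝓝 (f' x)))
    (hu : ∀ᶠ N in atTop, ListsIncreasing (u N) (Set.Icc 1 N) {x | 0 ≤ x ∧ p N x = 0})
    (hw : ListsIncreasing w (Set.Ici 1) {x | 0 < x ∧ f x = 0}) (h0 : f 0 ≠ 0)
    (hsimple : ∀ x, 0 < x → f x = 0 → f' x ≠ 0) {i : ℕ} (hi : 1 ≤ i) :
    Tendsto (fun N => u N i) atTop (𝓝 (w i)) := by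
  have hwi : ∀ i, 0 < w (i + 1) ∧ f (w (i + 1)) = 0 := fun i =>
    hw.2.subset ⟨i + 1, by simp, rfl⟩
  -- Beyond a suitable `c` between two consecutive zeros of `f`, the first zero of `p N` is the
  -- one with the index of the first zero of `f`.
  have key : ∀ i : ℕ, ∃ c, 0 ≤ c ∧ c < w (i + 1) ∧ (∀ x ∈ Set.Ico c (w (i + 1)), f x ≠ 0) ∧
      ∀ᶠ N in atTop, IsLeast {x | c ≤ x ∧ p N x = 0} (u N (i + 1)) := by
    intro i
    induction i with
    | zero =>
      refine ⟨0, le_rfl, (hwi 0).1, fun x hx hx0 => ?_, ?_⟩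
      · rcases hx.1.eq_or_lt with rfl | hxp
        · exact h0 hx0
        · obtain ⟨k, hk, rfl⟩ := hw.2.superset ⟨hxp, hx0⟩
          exact absurd hx.2 (not_lt.2 (hw.1.monotoneOn (by simp) hk hk))
      · filter_upwards [hu, eventually_ge_atTop 1] with N hN hN1
        have h1 : (1 : ℕ) ∈ Set.Icc 1 N := ⟨le_rfl, hN1⟩
        refine ⟨hN.2.subset ⟨1, h1, rfl⟩, fun x hx => ?_⟩
        obtain ⟨k, hk, rfl⟩ := hN.2.superset hx
        exact hN.1.monotoneOn h1 hk hk.1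
    | succ i ih =>
      obtain ⟨c, hc, hcw, hne, hv⟩ := ih
      obtain ⟨-, r, hr, hd⟩ := tendsto_of_isLeast_zero hp hf hf' hc hcw hpf hpf' hne (hwi i).2
        (hsimple _ (hwi i).1 (hwi i).2) hv
      have hlt : w (i + 1) < w (i + 1 + 1) := hw.1 (by simp) (by simp) (by omega)
      obtain ⟨d, hd1, hd2⟩ := exists_between (lt_min hr hlt)
      have hd0 : 0 < d := (hwi i).1.trans hd1
      refine ⟨d, hd0.le, hd2.trans_le (min_le_right _ _), fun x hx hx0 => ?_, ?_⟩
      · obtain ⟨k, hk, rfl⟩ := hw.2.superset ⟨hd0.trans_le hx.1, hx0⟩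
        have h1 := (hw.1.lt_iff_lt (by simp) hk).1 (hd1.trans_le hx.1)
        have h2 := (hw.1.lt_iff_lt hk (by simp)).1 hx.2
        omega
      · filter_upwards [hu, eventually_ge_atTop (i + 1 + 1),
          hd d hd1 (hd2.trans_le (min_le_left _ _))] with N hN hN1 hN2
        have m1 : i + 1 ∈ Set.Icc 1 N := ⟨by omega, by omega⟩
        have m2 : i + 1 + 1 ∈ Set.Icc 1 N := ⟨by omega, hN1⟩
        have hz : p N (u N (i + 1 + 1)) = 0 := (hN.2.subset ⟨i + 1 + 1, m2, rfl⟩).2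
        refine ⟨⟨hN2.2 _ (hN.1 m1 m2 (by omega)) hz, hz⟩, fun x hx => ?_⟩
        obtain ⟨k, hk, rfl⟩ := hN.2.superset ⟨hd0.le.trans hx.1, hx.2⟩
        have h1 := (hN.1.lt_iff_lt m1 hk).1 (hN2.1.trans_le hx.1)
        exact hN.1.monotoneOn m2 hk h1
  obtain ⟨i, rfl⟩ := Nat.exists_eq_add_of_le' hi
  obtain ⟨c, hc, hcw, hne, hv⟩ := key i
  exact (tendsto_of_isLeast_zero hp hf hf' hc hcw hpf hpf' hne (hwi i).2
    (hsimple _ (hwi i).1 (hwi i).2) hv).1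

/-! ### Scaling limit near the origin -/

lemma laguerreL_eval_zero_succ (α : ℝ) (n : ℕ) :
    ((n : ℝ) + 1) * (laguerreL α (n + 1)).eval 0 = (α + 1) * (laguerreL (α + 1) n).eval 0 := by
  have e := congrArg (eval 0) (succ_mul_laguerreL_succ α n)
  simpa using e

/-- The Laguerre polynomial as the terminating series `₁F₁(-n; α + 1; x)`, written at `x / s`. -/
lemma laguerreL_eval_div {α : ℝ} (hα : -1 < α) (n s : ℕ) (x : ℝ) :
    (laguerreL α n).eval (x / s) = (laguerreL α n).eval 0 *
      ∑' k, (n.descFactorial k / (s : ℝ) ^ k) * zeroFOneTerm (α + 1) k x := by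
  rw [laguerreL_eval_zero, tsum_eq_sum (s := Finset.range (n + 1)) fun k hk => by
    rw [Nat.descFactorial_of_lt (by simpa using hk)]
    simp, laguerreL, eval_finsetSum, Finset.mul_sum]
  refine Finset.sum_congr rfl fun k hk => ?_
  obtain ⟨d, rfl⟩ := Nat.exists_eq_add_of_le (Nat.lt_succ_iff.1 (Finset.mem_range.1 hk))
  have h1 := (ascPochhammer_pos k (α + 1) (by linarith)).ne'
  have h2 : (ascPochhammer ℝ (k + d)).eval (α + 1) =
      (ascPochhammer ℝ k).eval (α + 1) * (ascPochhammer ℝ d).eval (α + k + 1) := by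
    rw [← ascPochhammer_mul, eval_mul, eval_comp]
    simp only [eval_add, eval_X, eval_natCast]
    rw [show α + 1 + (k : ℝ) = α + k + 1 by ring]
  have h3 : ((k + d).factorial : ℝ) = d.factorial * (k + d).descFactorial k := by
    have := Nat.factorial_mul_descFactorial (Nat.le_add_right k d)
    rw [Nat.add_sub_cancel_left] at this
    exact_mod_cast this.symm
  have h4 : ((k + d).descFactorial k : ℝ) ≠ 0 := by
    have : 0 < (k + d).descFactorial k := Nat.descFactorial_pos.2 (Nat.le_add_right k d)
    exact_mod_cast this.ne'
  rw [zeroFOneTerm, h2, h3, Nat.add_sub_cancel_left]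
  simp only [eval_mul, eval_C, eval_pow, eval_X]
  rw [neg_pow x, div_pow]
  field_simp

lemma tendsto_descFactorial_div_pow (a k : ℕ) :
    Tendsto (fun N : ℕ => ((N - a).descFactorial k : ℝ) / (N : ℝ) ^ k) atTop (𝓝 1) := by
  induction k with
  | zero => simp
  | succ k ih =>
    have h1 : Tendsto (fun N : ℕ => 1 - ((a + k : ℕ) : ℝ) / N) atTop (𝓝 1) := by
      simpa using (tendsto_const_div_atTop_nhds_zero_nat ((a + k : ℕ) : ℝ)).const_sub 1
    have h2 := h1.mul ih
    rw [one_mul] at h2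
    refine h2.congr' ?_
    filter_upwards [eventually_ge_atTop (a + k + 1)] with N hN
    have hN0 : (N : ℝ) ≠ 0 := by
      have : N ≠ 0 := by omega
      exact_mod_cast this
    rw [Nat.descFactorial_succ, Nat.sub_sub, Nat.cast_mul, Nat.cast_sub (by omega)]
    field_simp
    ring

lemma descFactorial_div_pow_le_one (a k N : ℕ) :
    ((N - a).descFactorial k : ℝ) / (N : ℝ) ^ k ≤ 1 := by
  refine div_le_one_of_le₀ ?_ (by positivity)
  exact_mod_cast (Nat.descFactorial_le_pow _ k).trans (Nat.pow_le_pow_left (Nat.sub_le _ _) k)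

/-- The Mehler–Heine limit, normalised at the origin. The index of the polynomial may lag behind
the scaling factor by a constant. -/
lemma tendsto_laguerreL_scaled {α : ℝ} (hα : -1 < α) (a : ℕ) (x₀ : ℝ) :
    Tendsto (fun q : ℕ × ℝ => (laguerreL α (q.1 - a)).eval (q.2 / q.1) /
      (laguerreL α (q.1 - a)).eval 0) (atTop ×ˢ 𝓝 x₀) (𝓝 (zeroFOne (α + 1) x₀)) := by
  have hc : 0 < α + 1 := by linarith
  have he : ∀ q : ℕ × ℝ, (laguerreL α (q.1 - a)).eval (q.2 / q.1) /
      (laguerreL α (q.1 - a)).eval 0 =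
      ∑' k, ((q.1 - a).descFactorial k / (q.1 : ℝ) ^ k) * zeroFOneTerm (α + 1) k q.2 := by
    intro q
    rw [laguerreL_eval_div hα, mul_div_cancel_left₀ _ (laguerreL_eval_zero_pos hα _).ne']
  simp only [he]
  refine tendsto_tsum_of_dominated_convergence
    (summable_zeroFOneTerm_bound (α + 1) (|x₀| + 1)) (fun k => ?_) ?_
  · have h1 : Tendsto (fun q : ℕ × ℝ => ((q.1 - a).descFactorial k : ℝ) / (q.1 : ℝ) ^ k)
        (atTop ×ˢ 𝓝 x₀) (𝓝 1) := (tendsto_descFactorial_div_pow a k).comp tendsto_fst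
    have hcont : Continuous (zeroFOneTerm (α + 1) k) := by
      unfold zeroFOneTerm
      fun_prop
    have h2 : Tendsto (fun q : ℕ × ℝ => zeroFOneTerm (α + 1) k q.2) (atTop ×ˢ 𝓝 x₀)
        (𝓝 (zeroFOneTerm (α + 1) k x₀)) := (hcont.tendsto x₀).comp tendsto_snd
    simpa using h1.mul h2
  · have h1 : ∀ᶠ x in 𝓝 x₀, |x| ≤ |x₀| + 1 :=
      (continuous_abs.tendsto x₀).eventually_le_const (lt_add_one _)
    filter_upwards [h1.prod_inr (atTop : Filter ℕ)] with q hq k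
    rw [norm_mul, Real.norm_of_nonneg (by positivity)]
    refine (mul_le_of_le_one_left (norm_nonneg _) (descFactorial_div_pow_le_one a k q.1)).trans ?_
    exact abs_zeroFOneTerm_le hc hq k

lemma tendsto_eval_div (r : ℝ[X]) (x₀ : ℝ) :
    Tendsto (fun q : ℕ × ℝ => r.eval (q.2 / q.1)) (atTop ×ˢ 𝓝 x₀) (𝓝 (r.eval 0)) := by
  have h : Tendsto (fun q : ℕ × ℝ => q.2 / (q.1 : ℝ)) (atTop ×ˢ 𝓝 x₀) (𝓝 0) :=
    Tendsto.div_atTop tendsto_snd (tendsto_natCast_atTop_atTop.comp tendsto_fst)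
  exact (r.continuous.tendsto 0).comp h

lemma xLaguerreI_succ (α : ℝ) (m n : ℕ) : xLaguerreI α m (n + 1) =
    xiPoly α m * laguerreL (α - 1) (n + 1) + xiPoly (α - 1) m * laguerreL α n := by
  rw [xLaguerreI, opAI, derivative_laguerreL_succ, sub_add_cancel]
  ring

lemma derivative_xLaguerreI_succ_succ (α : ℝ) (m n : ℕ) :
    derivative (xLaguerreI α m (n + 2)) =
      derivative (xiPoly α m) * laguerreL (α - 1) (n + 2) - xiPoly α m * laguerreL α (n + 1) +
      derivative (xiPoly (α - 1) m) * laguerreL α (n + 1) -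
      xiPoly (α - 1) m * laguerreL (α + 1) n := by
  rw [xLaguerreI_succ, derivative_add, derivative_mul, derivative_mul, derivative_laguerreL_succ,
    derivative_laguerreL_succ, sub_add_cancel]
  ring

/-- Near the origin the second summand of `xLaguerreI_succ` dominates: at `0`, the polynomial
`L_N^{(α-1)}` is smaller than `L_{N-1}^{(α)}` by the factor `α / N`. -/
lemma tendsto_xLaguerreI_scaled {α : ℝ} (hα : 0 < α) (m : ℕ) (x₀ : ℝ) :
    Tendsto (fun q : ℕ × ℝ => (xLaguerreI α m q.1).eval (q.2 / q.1) /
      (laguerreL α (q.1 - 1)).eval 0) (atTop ×ˢ 𝓝 x₀)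
      (𝓝 ((xiPoly (α - 1) m).eval 0 * zeroFOne (α + 1) x₀)) := by
  have hN : Tendsto (fun q : ℕ × ℝ => α / (q.1 : ℝ)) (atTop ×ˢ 𝓝 x₀) (𝓝 0) :=
    (tendsto_const_div_atTop_nhds_zero_nat α).comp tendsto_fst
  have h := ((tendsto_eval_div (xiPoly α m) x₀).mul
    (hN.mul (tendsto_laguerreL_scaled (by linarith : -1 < α - 1) 0 x₀))).add
    ((tendsto_eval_div (xiPoly (α - 1) m) x₀).mul
      (tendsto_laguerreL_scaled (by linarith : -1 < α) 1 x₀))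
  rw [zero_mul, mul_zero, zero_add] at h
  refine h.congr' ?_
  filter_upwards [(eventually_ge_atTop 1).prod_inl (𝓝 x₀)] with q hq
  obtain ⟨n, hn⟩ := Nat.exists_eq_add_of_le' hq
  have e1 := laguerreL_eval_zero_succ (α - 1) n
  rw [sub_add_cancel] at e1
  have e2 := (laguerreL_eval_zero_pos (by linarith : -1 < α - 1) (n + 1)).ne'
  have e3 := (laguerreL_eval_zero_pos (by linarith : -1 < α) n).ne'
  have e4 : (laguerreL α n).eval 0 = (n + 1) * (laguerreL (α - 1) (n + 1)).eval 0 / α := by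
    rw [e1]
    field_simp
  have e5 : (n : ℝ) + 1 ≠ 0 := by positivity
  simp only [hn, xLaguerreI_succ, Nat.sub_zero, Nat.add_sub_cancel, eval_add, eval_mul]
  rw [e4]
  push_cast
  field_simp

lemma tendsto_derivative_xLaguerreI_scaled {α : ℝ} (hα : 0 < α) (m : ℕ) (x₀ : ℝ) :
    Tendsto (fun q : ℕ × ℝ => (derivative (xLaguerreI α m q.1)).eval (q.2 / q.1) * (1 / q.1) /
      (laguerreL α (q.1 - 1)).eval 0) (atTop ×ˢ 𝓝 x₀)
      (𝓝 ((xiPoly (α - 1) m).eval 0 * (-(zeroFOne (α + 1 + 1) x₀) / (α + 1)))) := by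
  have hN : ∀ c : ℝ, Tendsto (fun q : ℕ × ℝ => c / (q.1 : ℝ)) (atTop ×ˢ 𝓝 x₀) (𝓝 0) :=
    fun c => (tendsto_const_div_atTop_nhds_zero_nat c).comp tendsto_fst
  have hL1 := tendsto_laguerreL_scaled (by linarith : -1 < α) 1 x₀
  have h := ((hN 1).mul ((((tendsto_eval_div (derivative (xiPoly α m)) x₀).mul
    ((hN α).mul (tendsto_laguerreL_scaled (by linarith : -1 < α - 1) 0 x₀))).sub
    ((tendsto_eval_div (xiPoly α m) x₀).mul hL1)).add
    ((tendsto_eval_div (derivative (xiPoly (α - 1) m)) x₀).mul hL1))).sub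
    ((tendsto_eval_div (xiPoly (α - 1) m) x₀).mul
      ((((hN 1).const_sub 1).div_const (α + 1)).mul
        (tendsto_laguerreL_scaled (by linarith : -1 < α + 1) 2 x₀)))
  have hl : ∀ a b c z : ℝ, 0 * a - b * ((1 - 0) / c * z) = b * (-z / c) := fun a b c z => by ring
  rw [hl] at h
  refine h.congr' ?_
  filter_upwards [(eventually_ge_atTop 2).prod_inl (𝓝 x₀)] with q hq
  obtain ⟨n, hn⟩ := Nat.exists_eq_add_of_le' hq
  have e1 := laguerreL_eval_zero_succ (α - 1) (n + 1)
  have e2 := laguerreL_eval_zero_succ α n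
  rw [sub_add_cancel] at e1
  have p1 := (laguerreL_eval_zero_pos (by linarith : -1 < α - 1) (n + 2)).ne'
  have p2 := (laguerreL_eval_zero_pos (by linarith : -1 < α) (n + 1)).ne'
  have p3 := (laguerreL_eval_zero_pos (by linarith : -1 < α + 1) n).ne'
  have e3 : (laguerreL (α - 1) (n + 2)).eval 0 = α * (laguerreL α (n + 1)).eval 0 / (n + 2) := by
    rw [← e1]
    push_cast
    field_simp
    ring
  have e4 : (laguerreL (α + 1) n).eval 0 = (n + 1) * (laguerreL α (n + 1)).eval 0 / (α + 1) := by
    rw [e2]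
    field_simp
  have e5 : (n : ℝ) + 1 ≠ 0 := by positivity
  have e6 : (n : ℝ) + 2 ≠ 0 := by positivity
  have e7 : α + 1 ≠ 0 := by positivity
  simp only [hn, derivative_xLaguerreI_succ_succ, Nat.sub_zero, Nat.add_sub_cancel,
    show n + 2 - 1 = n + 1 from rfl, eval_add, eval_sub, eval_mul]
  rw [e3, e4]
  push_cast
  field_simp
  ring

/-! ### The zeros in the scaling limit -/

lemma ListsIncreasing.comp_strictMonoOn {u : ℕ → ℝ} {I : Set ℕ} {S T : Set ℝ}
    (h : ListsIncreasing u I S) {g : ℝ → ℝ} (hg : StrictMonoOn g S) (hST : g '' S = T) :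
    ListsIncreasing (fun i => g (u i)) I T := by
  refine ⟨fun i hi j hj hij => hg (h.2.subset ⟨i, hi, rfl⟩) (h.2.subset ⟨j, hj, rfl⟩)
    (h.1 hi hj hij), ?_⟩
  rw [← hST, ← h.2, Set.image_image]

theorem mainTheorem2 (α : ℝ) (hα : 0 < α) (m : ℕ) :
    (∀ j : ℕ, ∃ u : ℕ → ℝ, ListsIncreasing u (Set.Icc 1 j) (regularZeros α m j)) ∧
    (∃ z : ℕ → ℝ, ListsIncreasing z (Set.Ici 1) (besselZeros α)) ∧
    ∀ (x : ℕ → ℕ → ℝ) (z : ℕ → ℝ),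
      (∀ j : ℕ, ListsIncreasing (x j) (Set.Icc 1 j) (regularZeros α m j)) →
      ListsIncreasing z (Set.Ici 1) (besselZeros α) →
      ∀ i : ℕ, 1 ≤ i →
        Filter.Tendsto (fun j : ℕ => (j : ℝ) * x j i) Filter.atTop (nhds (z i ^ 2 / 4)) := by
  refine ⟨fun j => ?_, exists_listsIncreasing_besselZeros hα, fun x z hx hz i hi => ?_⟩
  · obtain ⟨s, hs1, hs2⟩ := exists_finset_eq_regularZeros hα m j
    obtain ⟨u, hu⟩ := exists_listsIncreasing_of_finset s
    exact ⟨u, by rwa [hs1, hs2] at hu⟩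
  have hc : 0 < α + 1 := by linarith
  have hα1 : -1 < α := by linarith
  set κ := (xiPoly (α - 1) m).eval 0
  have hκ : κ ≠ 0 := ((laguerreL_eval_zero_pos (by linarith : -1 < α - 1) m).trans_le
    (xiPoly_eval_zero_le (by linarith) m le_rfl)).ne'
  refine tendsto_listed_zeros
    (p := fun N x => (xLaguerreI α m N).eval (x / N) / (laguerreL α (N - 1)).eval 0)
    (p' := fun N x => (derivative (xLaguerreI α m N)).eval (x / N) * (1 / N) /
      (laguerreL α (N - 1)).eval 0)
    (f := fun x => κ * zeroFOne (α + 1) x)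
    (f' := fun x => κ * (-(zeroFOne (α + 1 + 1) x) / (α + 1)))
    (u := fun N i => (N : ℝ) * x N i) (w := fun i => z i ^ 2 / 4)
    ?_ ?_ ?_ ?_ ?_ ?_ ?_ ?_ ?_ hi
  · intro N y
    exact ((((xLaguerreI α m N).hasDerivAt (y / N)).comp y
      ((hasDerivAt_id y).div_const (N : ℝ)))).div_const _
  · exact fun y => (hasDerivAt_zeroFOne hc y).const_mul κ
  · have := continuous_zeroFOne (by linarith : 0 < α + 1 + 1)
    fun_prop
  · exact fun y _ => tendsto_xLaguerreI_scaled hα m y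
  · exact fun y _ => tendsto_derivative_xLaguerreI_scaled hα m y
  · filter_upwards [eventually_ge_atTop 1] with N hN
    have hN0 : (0 : ℝ) < N := by exact_mod_cast hN
    have hL := (laguerreL_eval_zero_pos hα1 (N - 1)).ne'
    refine (hx N).comp_strictMonoOn (g := fun y => N * y)
      (fun a _ b _ hab => mul_lt_mul_of_pos_left hab hN0) ?_
    ext y
    constructor
    · rintro ⟨t, ht, rfl⟩
      refine ⟨mul_nonneg hN0.le ht.1, ?_⟩
      simp only
      rw [mul_div_cancel_left₀ _ hN0.ne', ht.2, zero_div]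
    · rintro ⟨hy, hy0⟩
      exact ⟨y / N, ⟨by positivity, (div_eq_zero_iff.1 hy0).resolve_right hL⟩,
        mul_div_cancel₀ _ hN0.ne'⟩
  · refine hz.comp_strictMonoOn (g := fun t => t ^ 2 / 4) ?_ ?_
    · intro a ha b _ hab
      have := pow_lt_pow_left₀ hab ha.1.le two_ne_zero
      simp only
      linarith
    · ext y
      constructor
      · rintro ⟨t, ht, rfl⟩
        obtain ⟨ht0, ht1⟩ := (mem_besselZeros_iff hα1).1 ht
        exact ⟨by positivity, by simp [ht1]⟩
      · rintro ⟨hy, hy0⟩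
        have hsq : (2 * √y) ^ 2 / 4 = y := by
          rw [mul_pow, Real.sq_sqrt hy.le]
          ring
        refine ⟨2 * √y, (mem_besselZeros_iff hα1).2 ⟨by positivity, ?_⟩, hsq⟩
        rw [hsq]
        exact (mul_eq_zero.1 hy0).resolve_left hκ
  · simp [zeroFOne_zero, hκ]
  · intro y hy hy0
    have h1 := zeroFOne_add_one_ne_zero hc hy ((mul_eq_zero.1 hy0).resolve_left hκ)
    exact mul_ne_zero hκ (div_ne_zero (neg_ne_zero.2 h1) hc.ne')
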